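/- **Setting.** Let $(\alpha_n)_{n\ge 1},(\beta_n)_{n\ge 1}$ be sequences in $(0,1]$ and $(p_n)_{n\ge 1}$ a sequence of positive reals. For $i\ge 1$ let $(\mathcal X_i,K_i,\pi_i)$ be the two-state Markov chain $$\mathcal X_i=\{0,1\},\qquad K_i=\begin{pmatrix}1-\alpha_i&\alpha_i\\ \beta_i&1-\beta_i\end{pmatrix},\qquad \pi_i=\Big(\tfrac{\beta_i}{\alpha_i+\beta_i},\tfrac{\alpha_i}{\alpha_i+\beta_i}\Big).$$ For $n\ge 1$ put $q_n=p_1+\dots+p_n$, $\mathcal Y_n=\{0,1\}^n$, $\nu_n=\pi_1\times\dots\times\pi_n$ and $$L_n=\sum_{i=1}^n\frac{p_i}{q_n}\,I\otimes\cdots\otimes I\otimes K_i\otimes I\otimes\cdots\otimes I\quad(K_i\text{ in the }i\text{th position}).$$ Consider the continuous time chain with transition matrices $H_{n,t}=e^{-t(I-L_n)}$, $t\ge 0$, started at the zero vector $\mathbf 0\in\mathcal Y_n$, and set $$d_{n,\mathrm{TV}}(t)=\sup_{A\subset\mathcal Y_n}\{H_{n,t}(\mathbf 0,A)-\nu_n(A)\},\qquad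 d_{n,2}(t)=\Big(\sum_{y\in\mathcal Y_n}\Big|\frac{H_{n,t}(\mathbf 0,y)}{\nu_n(y)}-1\Big|^2\nu_n(y)\Big)^{1/2},$$ $$T_{n,\mathrm{TV}}(\epsilon)=\inf\{t\ge 0: d_{n,\mathrm{TV}}(t)\le\epsilon\},\qquad T_{n,2}(\epsilon)=\inf\{t\ge 0: d_{n,2}(t)\le\epsilon\}.$$ **Cutoffs.** Let $(d_n,M)$ be $(d_{n,\mathrm{TV}},1)$ or $(d_{n,2},\infty)$. The family has a *total variation cutoff*, respectively an *$L^2$-cutoff*, if there are $t_n>0$ such that $d_n(at_n)\to 0$ for every $a>1$ and $d_n(at_n)\to M$ for every $a\in(0,1)$, as $n\to\infty$. It has a *$(t_n,b_n)$ total variation cutoff*, respectively a *$(t_n,b_n)$ $L^2$-cutoff*, if $t_n>0$, $b_n>0$, $b_n=o(t_n)$ and $$\lim_{c\to\infty}\limsup_{n\to\infty}d_n(t_n+cb_n)=0,\qquad \lim_{c\to-\infty}\liminf_{n\to\infty}d_n(t_n+cb_n)=M.$$ **Proposition.** Assume $\sup_n \alpha_n/\beta_n<\infty$. Then: 1. The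 family has a total variation cutoff if and only if it has an $L^2$-cutoff. Furthermore, if these cutoffs exist, then $T_{n,\mathrm{TV}}(\epsilon)/T_{n,2}(\delta)\to 1$ as $n\to\infty$ for all $\epsilon\in(0,1)$ and $\delta>0$. 2. For all sequences $(t_n)$ and $(b_n)$ of reals, the family has a $(t_n,b_n)$ total variation cutoff if and only if it has a $(t_n,b_n)$ $L^2$-cutoff. -/

import Mathlib

open Filter Topology Asymptotics

noncomputable section

namespace ProductCutoff

/-! ### Finite continuous time Markov chains -/

section Chain

variable {X : Type*} [Fintype X] [DecidableEq X]

/-- The semigroup `H_t = exp (-t (I - K))` of the continuous time chain associated with a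
transition matrix `K`. -/
def semigroup (K : Matrix X X ℝ) (t : ℝ) : Matrix X X ℝ :=
  NormedSpace.exp ((-t) • (1 - K))

/-- The law at time `t` of the continuous time chain associated with `K` and started at the
state `x`, as a vector of probabilities: `δ_x H_t`. -/
def law (K : Matrix X X ℝ) (x : X) (t : ℝ) : X → ℝ :=
  Matrix.vecMul (Pi.single x 1) (semigroup K t)

/-- Total variation distance `sup_A (μ(A) - ν(A))`. -/
def tv (μ ν : X → ℝ) : ℝ :=
  ⨆ A : Finset X, (∑ y ∈ A, μ y - ∑ y ∈ A, ν y)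

/-- The `L²(π)`-distance `(∑_y |μ(y)/π(y) - 1|² π(y))^{1/2}` of `μ` from `π`. -/
def lTwo (μ π : X → ℝ) : ℝ :=
  Real.sqrt (∑ y, |μ y / π y - 1| ^ 2 * π y)

/-- Total variation distance to `π` at time `t`, started at `x`. -/
def dTV (K : Matrix X X ℝ) (π : X → ℝ) (x : X) (t : ℝ) : ℝ := tv (law K x t) π

/-- `L²`-distance to `π` at time `t`, started at `x`. -/
def dTwo (K : Matrix X X ℝ) (π : X → ℝ) (x : X) (t : ℝ) : ℝ := lTwo (law K x t) π

end Chain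

/-- The mixing time `inf {t ≥ 0 | d(t) ≤ ε}` of a distance function `d`. -/
def mixingTime (d : ℝ → ℝ) (ε : ℝ) : ℝ := sInf {t : ℝ | 0 ≤ t ∧ d t ≤ ε}

/-! ### Product chains -/

section Product

variable {ι : Type*} [Fintype ι] [DecidableEq ι] {X : ι → Type*} [∀ i, DecidableEq (X i)]

/-- The tensor product `⨂ i, A i` of a finite family of square matrices. -/
def tensor (A : ∀ i, Matrix (X i) (X i) ℝ) : Matrix (∀ i, X i) (∀ i, X i) ℝ :=
  Matrix.of fun x y => ∏ i, A i (x i) (y i)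

/-- The transition matrix `∑ i, w i • (I ⊗ ⋯ ⊗ I ⊗ K i ⊗ I ⊗ ⋯ ⊗ I)` of the product chain
according to the probability vector `w`. -/
def productMatrix (w : ι → ℝ) (K : ∀ i, Matrix (X i) (X i) ℝ) :
    Matrix (∀ i, X i) (∀ i, X i) ℝ :=
  ∑ i, w i • tensor (Function.update (fun j => (1 : Matrix (X j) (X j) ℝ)) i (K i))

/-- The product measure of the `π i`. -/
def productMeasure (π : ∀ i, X i → ℝ) : (∀ i, X i) → ℝ := fun x => ∏ i, π i (x i)

end Product

/-! ### Products of two-state chains -/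

/-- The two-state transition matrix on `{0, 1}`. -/
def twoStateK (α β : ℝ) : Matrix (Fin 2) (Fin 2) ℝ := !![1 - α, α; β, 1 - β]

/-- The stationary distribution of the two-state chain. -/
def twoStatePi (α β : ℝ) : Fin 2 → ℝ := ![β / (α + β), α / (α + β)]

/-- Given sequences `α 0, α 1, …`, `β 0, β 1, …` and `p 0, p 1, …`, the transition matrix of the
`n`-th product chain. Sequences are indexed from `0`, so the `n`-th product chain is the product of
the `n + 1` two-state chains with indices `0, …, n`, according to the probability vector
`p i / (p 0 + ⋯ + p n)`. -/
def chainK (α β p : ℕ → ℝ) (n : ℕ) : Matrix (Fin (n + 1) → Fin 2) (Fin (n + 1) → Fin 2) ℝ :=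
  productMatrix (fun i : Fin (n + 1) => p i / ∑ j : Fin (n + 1), p j)
    (fun i : Fin (n + 1) => twoStateK (α i) (β i))

/-- The stationary distribution of the `n`-th product chain. -/
def chainPi (α β : ℕ → ℝ) (n : ℕ) : (Fin (n + 1) → Fin 2) → ℝ :=
  productMeasure fun i : Fin (n + 1) => twoStatePi (α i) (β i)

/-- Total variation distance at time `t` of the `n`-th continuous time product chain, started at
the zero vector. -/
def chainTV (α β p : ℕ → ℝ) (n : ℕ) (t : ℝ) : ℝ :=
  dTV (chainK α β p n) (chainPi α β n) 0 t

/-- `L²`-distance at time `t` of the `n`-th continuous time product chain, started at the zero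
vector. -/
def chainTwo (α β p : ℕ → ℝ) (n : ℕ) (t : ℝ) : ℝ :=
  dTwo (chainK α β p n) (chainPi α β n) 0 t

/-! ### Cutoffs

`d n t` is the distance of the `n`-th chain at time `t`, and `M` is the limiting value before the
cutoff: `1` for the total variation distance and `∞` for the `L²`-distance. Limits are taken in the
extended reals, so that a `limsup` or `liminf` of an unbounded sequence has its usual meaning. -/

/-- The family presents a cutoff. -/
def HasCutoff (M : EReal) (d : ℕ → ℝ → ℝ) : Prop :=
  ∃ t : ℕ → ℝ, (∀ n, 0 < t n) ∧
    (∀ a : ℝ, 1 < a → Tendsto (fun n => (d n (a * t n) : EReal)) atTop (𝓝 0)) ∧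
    (∀ a : ℝ, 0 < a → a < 1 → Tendsto (fun n => (d n (a * t n) : EReal)) atTop (𝓝 M))

/-- The family presents a `(t_n, b_n)` cutoff. -/
def HasWindowCutoff (M : EReal) (d : ℕ → ℝ → ℝ) (t b : ℕ → ℝ) : Prop :=
  (∀ n, 0 < t n) ∧ (∀ n, 0 < b n) ∧ b =o[atTop] t ∧
    Tendsto (fun c : ℝ => limsup (fun n => (d n (t n + c * b n) : EReal)) atTop) atTop (𝓝 0) ∧
    Tendsto (fun c : ℝ => liminf (fun n => (d n (t n + c * b n) : EReal)) atTop) atBot (𝓝 M)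

end ProductCutoff

end

open ProductCutoff

/-!
Since `1 + lTwo ^ 2` is multiplicative over products of measures and `1 - tv` is at most the
Hellinger affinity `∑ √(μ π)`, which is multiplicative as well, the two distances can be compared
factor by factor. If the density `μ / π` of a factor is at most `B`, then its affinity is at most
`1 - c * lTwo ^ 2 ≤ (1 + lTwo ^ 2) ^ (-c)` with `c = 1 / (4 * (1 + B))`, whence
`1 - tv ≤ (1 + lTwo ^ 2) ^ (-c)` for the product, uniformly in the number of factors. Together with
the Cauchy-Schwarz bound `tv ^ 2 ≤ (1 - tv) * lTwo ^ 2`, this shows that `tv` tends to `0` exactly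
when `lTwo` does, and to `1` exactly when `lTwo` tends to `∞`, along any filter. Each factor of the
product chain is reversible, so that the density of its law is at most `1 / π x`, where `x` is its
starting state, and boundedness of `α n / β n` keeps `π x` away from `0`.
-/

namespace ProductCutoff

section Distances

variable {X : Type*} {μ π : X → ℝ}

theorem sum_sub_sum_le_tv [Finite X] (μ π : X → ℝ) (A : Finset X) :
    ∑ y ∈ A, μ y - ∑ y ∈ A, π y ≤ tv μ π :=
  le_ciSup (f := fun A : Finset X => ∑ y ∈ A, μ y - ∑ y ∈ A, π y) (Set.finite_range _).bddAbove A

theorem exists_sum_sub_sum_eq_tv [Finite X] (μ π : X → ℝ) :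
    ∃ A : Finset X, ∑ y ∈ A, μ y - ∑ y ∈ A, π y = tv μ π :=
  exists_eq_ciSup_of_finite

variable [Fintype X]

theorem lTwo_nonneg (μ π : X → ℝ) : 0 ≤ lTwo μ π := Real.sqrt_nonneg _

theorem lTwo_sq (μ : X → ℝ) (hπ : ∀ x, 0 ≤ π x) :
    lTwo μ π ^ 2 = ∑ x, |μ x / π x - 1| ^ 2 * π x :=
  Real.sq_sqrt <| Finset.sum_nonneg fun x _ => mul_nonneg (sq_nonneg _) (hπ x)

theorem one_add_lTwo_sq (hπ : ∀ x, 0 < π x) (hμ_sum : ∑ x, μ x = 1) (hπ_sum : ∑ x, π x = 1) :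
    1 + lTwo μ π ^ 2 = ∑ x, μ x ^ 2 / π x := by
  have expand (x : X) : |μ x / π x - 1| ^ 2 * π x = μ x ^ 2 / π x - 2 * μ x + π x := by
    have := (hπ x).ne'
    rw [sq_abs]
    field_simp
    ring
  simp only [lTwo_sq μ fun x => (hπ x).le, expand, Finset.sum_add_distrib,
    Finset.sum_sub_distrib, ← Finset.mul_sum, hμ_sum, hπ_sum]
  ring

/-- If `A` is optimal then `π(A) = μ(A) - tv ≤ 1 - tv`; keeping this factor in the Cauchy-Schwarz
inequality makes the bound force `lTwo` to be large when `tv` is close to `1`. -/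
theorem tv_sq_le (hμ : μ ∈ stdSimplex ℝ X) (hπ : ∀ x, 0 < π x) :
    tv μ π ^ 2 ≤ (1 - tv μ π) * lTwo μ π ^ 2 := by
  obtain ⟨A, hA⟩ := exists_sum_sub_sum_eq_tv μ π
  have density_nonneg (x : X) : 0 ≤ |μ x / π x - 1| ^ 2 * π x :=
    mul_nonneg (sq_nonneg _) (hπ x).le
  have hμA : ∑ x ∈ A, μ x ≤ 1 :=
    hμ.2 ▸ Finset.sum_le_univ_sum_of_nonneg hμ.1
  calc tv μ π ^ 2 = (∑ x ∈ A, (μ x - π x)) ^ 2 := by rw [← hA, Finset.sum_sub_distrib]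
    _ ≤ (∑ x ∈ A, π x) * ∑ x ∈ A, |μ x / π x - 1| ^ 2 * π x := by
      refine Finset.sum_sq_le_sum_mul_sum_of_sq_le_mul A (fun x _ => (hπ x).le)
        (fun x _ => density_nonneg x) fun x _ => le_of_eq ?_
      have := (hπ x).ne'
      rw [sq_abs]
      field_simp
    _ ≤ (1 - tv μ π) * lTwo μ π ^ 2 := by
      rw [lTwo_sq μ fun x => (hπ x).le]
      refine mul_le_mul (by linarith) (Finset.sum_le_univ_sum_of_nonneg density_nonneg)
        (Finset.sum_nonneg fun x _ => density_nonneg x) ?_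
      linarith [Finset.sum_nonneg fun x (_ : x ∈ A) => (hπ x).le]

theorem one_sub_tv_le_sum_sqrt (hμ : μ ∈ stdSimplex ℝ X) (hπ : ∀ x, 0 ≤ π x) :
    1 - tv μ π ≤ ∑ x, √(μ x * π x) := by
  classical
  let A : Finset X := {x | π x ≤ μ x}
  calc 1 - tv μ π ≤ ∑ x, μ x - (∑ x ∈ A, μ x - ∑ x ∈ A, π x) := by
        rw [hμ.2]; gcongr; exact sum_sub_sum_le_tv μ π A
    _ = ∑ x, min (μ x) (π x) := by
      rw [← Finset.sum_sub_distrib, Finset.sum_filter, ← Finset.sum_sub_distrib]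
      refine Finset.sum_congr rfl fun x _ => ?_
      split_ifs with h
      · rw [min_eq_right h, sub_sub_cancel]
      · rw [min_eq_left (le_of_not_ge h), sub_zero]
    _ ≤ ∑ x, √(μ x * π x) := by
      refine Finset.sum_le_sum fun x _ => Real.le_sqrt_of_sq_le ?_
      rw [sq]
      exact mul_le_mul (min_le_left _ _) (min_le_right _ _) (le_min (hμ.1 x) (hπ x)) (hμ.1 x)

theorem sqrt_le_of_le {f B : ℝ} (hf : 0 ≤ f) (hfB : f ≤ B) :
    √f ≤ (f + 1) / 2 - 1 / (4 * (1 + B)) * (f - 1) ^ 2 := by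
  obtain ⟨s, hs, rfl⟩ : ∃ s : ℝ, 0 ≤ s ∧ f = s ^ 2 :=
    ⟨√f, Real.sqrt_nonneg f, (Real.sq_sqrt hf).symm⟩
  have hB : 0 < 4 * (1 + B) := by linarith
  have hsq : 1 / (4 * (1 + B)) * (s + 1) ^ 2 ≤ 1 / 2 := by
    rw [div_mul_eq_mul_div, div_le_div_iff₀ hB two_pos]
    linarith [sq_nonneg (s - 1)]
  calc √(s ^ 2) = (s ^ 2 + 1) / 2 - 1 / 2 * (s - 1) ^ 2 := by rw [Real.sqrt_sq hs]; ring
    _ ≤ (s ^ 2 + 1) / 2 - 1 / (4 * (1 + B)) * (s + 1) ^ 2 * (s - 1) ^ 2 := by gcongr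
    _ = (s ^ 2 + 1) / 2 - 1 / (4 * (1 + B)) * (s ^ 2 - 1) ^ 2 := by ring

theorem sum_sqrt_le {B : ℝ} (hμ : μ ∈ stdSimplex ℝ X) (hπ : ∀ x, 0 < π x)
    (hπ_sum : ∑ x, π x = 1) (hB : ∀ x, μ x ≤ B * π x) :
    ∑ x, √(μ x * π x) ≤ 1 - 1 / (4 * (1 + B)) * lTwo μ π ^ 2 := by
  have pointwise (x : X) : √(μ x * π x) ≤
      (μ x + π x) / 2 - 1 / (4 * (1 + B)) * (|μ x / π x - 1| ^ 2 * π x) :=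
    calc √(μ x * π x) = √(μ x / π x) * π x := by
          rw [← Real.sqrt_sq (hπ x).le, ← Real.sqrt_mul (div_nonneg (hμ.1 x) (Real.sqrt_nonneg _)),
            Real.sqrt_sq (hπ x).le, sq, ← mul_assoc, div_mul_cancel₀ _ (hπ x).ne']
      _ ≤ ((μ x / π x + 1) / 2 - 1 / (4 * (1 + B)) * (μ x / π x - 1) ^ 2) * π x :=
        mul_le_mul_of_nonneg_right (sqrt_le_of_le (div_nonneg (hμ.1 x) (hπ x).le)
          ((div_le_iff₀ (hπ x)).2 (hB x))) (hπ x).le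
      _ = _ := by
        have := (hπ x).ne'
        rw [sq_abs]
        field_simp
  calc ∑ x, √(μ x * π x)
      ≤ ∑ x, ((μ x + π x) / 2 - 1 / (4 * (1 + B)) * (|μ x / π x - 1| ^ 2 * π x)) :=
        Finset.sum_le_sum fun x _ => pointwise x
    _ = 1 - 1 / (4 * (1 + B)) * lTwo μ π ^ 2 := by
      rw [lTwo_sq μ fun x => (hπ x).le, Finset.sum_sub_distrib, ← Finset.sum_div,
        Finset.sum_add_distrib, ← Finset.mul_sum, hμ.2, hπ_sum]
      norm_num

end Distances

section Reversible

variable {X : Type*} [Fintype X] [DecidableEq X] {P Q K : Matrix X X ℝ} {μ π : X → ℝ}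

/-- `P` is a stochastic matrix satisfying the detailed balance equations with respect to `π`. -/
structure IsReversible (P : Matrix X X ℝ) (π : X → ℝ) : Prop where
  mem_rowStochastic : P ∈ Matrix.rowStochastic ℝ X
  detailed_balance (x y : X) : π x * P x y = π y * P y x

namespace IsReversible

theorem vecMul_eq (h : IsReversible P π) : Matrix.vecMul π P = π := by
  ext y
  simp only [Matrix.vecMul, dotProduct, h.detailed_balance _ y, ← Finset.mul_sum,
    Matrix.sum_row_of_mem_rowStochastic h.mem_rowStochastic, mul_one]

theorem mul_apply_le (h : IsReversible P π) (hπ : ∀ x, 0 ≤ π x) (x y : X) :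
    π x * P x y ≤ π y := by
  rw [h.detailed_balance]
  exact mul_le_of_le_one_right (hπ y) (Matrix.le_one_of_mem_rowStochastic h.mem_rowStochastic)

theorem one (π : X → ℝ) : IsReversible (1 : Matrix X X ℝ) π where
  mem_rowStochastic := one_mem _
  detailed_balance x y := by
    obtain rfl | hxy := eq_or_ne x y
    · rfl
    · rw [Matrix.one_apply_ne hxy, Matrix.one_apply_ne hxy.symm, mul_zero, mul_zero]

theorem pow (h : IsReversible P π) (k : ℕ) : IsReversible (P ^ k) π where
  mem_rowStochastic := pow_mem h.mem_rowStochastic k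
  detailed_balance := by
    have hD : Matrix.diagonal π * P = P.transpose * Matrix.diagonal π := by
      ext x y
      rw [Matrix.diagonal_mul, Matrix.mul_diagonal, h.detailed_balance, Matrix.transpose_apply,
        mul_comm]
    intro x y
    have := congrFun₂ (SemiconjBy.pow_right (a := Matrix.diagonal π) hD k) x y
    rwa [Matrix.diagonal_mul, ← Matrix.transpose_pow, Matrix.mul_diagonal, Matrix.transpose_apply,
      mul_comm _ (π y)] at this

theorem of_hasSum {ι : Type*} {a : ι → ℝ} {P : ι → Matrix X X ℝ}
    (hP : ∀ i, IsReversible (P i) π) (ha : ∀ i, 0 ≤ a i) (ha_sum : HasSum a 1)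
    (hQ : HasSum (fun i => a i • P i) Q) : IsReversible Q π := by
  have entry (x y : X) : HasSum (fun i => a i * P i x y) (Q x y) :=
    Pi.hasSum.1 (Pi.hasSum.1 hQ x) y
  refine ⟨Matrix.mem_rowStochastic_iff_sum.2 ⟨fun x y => ?_, fun x => ?_⟩, fun x y => ?_⟩
  · exact (entry x y).nonneg fun i =>
      mul_nonneg (ha i) (Matrix.nonneg_of_mem_rowStochastic (hP i).mem_rowStochastic)
  · refine HasSum.unique (hasSum_sum fun y _ => entry x y) ?_
    simpa only [← Finset.mul_sum, mul_one,
      Matrix.sum_row_of_mem_rowStochastic (hP _).mem_rowStochastic] using ha_sum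
  · refine ((entry x y).mul_left (π x)).unique ?_
    simpa only [mul_left_comm _ (a _), (hP _).detailed_balance x y] using
      (entry y x).mul_left (π y)

end IsReversible

theorem tv_vecMul_le (hP : P ∈ Matrix.rowStochastic ℝ X) (μ π : X → ℝ) :
    tv (Matrix.vecMul μ P) (Matrix.vecMul π P) ≤ tv μ π := by
  refine ciSup_le fun A => le_trans ?_ (sum_sub_sum_le_tv μ π {x | π x ≤ μ x})
  have hPA (x : X) : 0 ≤ ∑ y ∈ A, P x y ∧ ∑ y ∈ A, P x y ≤ 1 :=
    ⟨Finset.sum_nonneg fun y _ => hP.1 x y, (Finset.sum_le_univ_sum_of_nonneg (hP.1 x)).trans_eq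
      (Matrix.sum_row_of_mem_rowStochastic hP x)⟩
  calc ∑ y ∈ A, Matrix.vecMul μ P y - ∑ y ∈ A, Matrix.vecMul π P y
      = ∑ x, (μ x - π x) * ∑ y ∈ A, P x y := by
        simp only [Matrix.vecMul, dotProduct, sub_mul, Finset.sum_sub_distrib, Finset.mul_sum]
        rw [Finset.sum_comm, Finset.sum_comm (s := A)]
    _ ≤ ∑ x, if π x ≤ μ x then μ x - π x else 0 := by
      refine Finset.sum_le_sum fun x _ => ?_
      split_ifs with h
      · exact mul_le_of_le_one_right (sub_nonneg.2 h) (hPA x).2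
      · exact mul_nonpos_of_nonpos_of_nonneg (sub_nonpos.2 (le_of_not_ge h)) (hPA x).1
    _ = ∑ x with π x ≤ μ x, μ x - ∑ x with π x ≤ μ x, π x := by
      rw [← Finset.sum_sub_distrib, Finset.sum_filter]

theorem lTwo_vecMul_le (hP : IsReversible P π) (hπ : ∀ x, 0 < π x) (μ : X → ℝ) :
    lTwo (Matrix.vecMul μ P) π ≤ lTwo μ π := by
  have density (y : X) :
      Matrix.vecMul μ P y / π y - 1 = ∑ x, P y x * (μ x / π x - 1) := by
    simp only [mul_sub, mul_one, Finset.sum_sub_distrib, Matrix.vecMul, dotProduct,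
      Matrix.sum_row_of_mem_rowStochastic hP.mem_rowStochastic, Finset.sum_div]
    congr 1
    refine Finset.sum_congr rfl fun x _ => ?_
    rw [mul_div_assoc', div_eq_div_iff (hπ y).ne' (hπ x).ne']
    linear_combination μ x * hP.detailed_balance x y
  have jensen (y : X) :
      |∑ x, P y x * (μ x / π x - 1)| ^ 2 ≤ ∑ x, P y x * |μ x / π x - 1| ^ 2 := by
    simp only [sq_abs]
    exact even_two.convexOn_pow.map_sum_le (fun x _ => hP.mem_rowStochastic.1 y x)
      (Matrix.sum_row_of_mem_rowStochastic hP.mem_rowStochastic y) fun x _ => Set.mem_univ _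
  refine Real.sqrt_le_sqrt ?_
  calc ∑ y, |Matrix.vecMul μ P y / π y - 1| ^ 2 * π y
      ≤ ∑ y, (∑ x, P y x * |μ x / π x - 1| ^ 2) * π y := by
        simp only [density]
        exact Finset.sum_le_sum fun y _ => mul_le_mul_of_nonneg_right (jensen y) (hπ y).le
    _ = ∑ x, |μ x / π x - 1| ^ 2 * Matrix.vecMul π P x := by
      simp only [Finset.sum_mul, Matrix.vecMul, dotProduct, Finset.mul_sum]
      rw [Finset.sum_comm]
      exact Finset.sum_congr rfl fun x _ => Finset.sum_congr rfl fun y _ => by ring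
    _ = ∑ x, |μ x / π x - 1| ^ 2 * π x := by rw [hP.vecMul_eq]

end Reversible

section Semigroup

variable {X : Type*} [Fintype X] [DecidableEq X] {K : Matrix X X ℝ} {π : X → ℝ}

attribute [local instance] Matrix.linftyOpNormedRing Matrix.linftyOpNormedAlgebra in
/-- The continuous time chain is the discrete time chain observed at a Poisson time. -/
theorem hasSum_semigroup (K : Matrix X X ℝ) (t : ℝ) :
    HasSum (fun k : ℕ => (Real.exp (-t) * (t ^ k / k.factorial)) • K ^ k) (semigroup K t) := by
  have hsplit : (-t) • (1 - K) = algebraMap ℝ (Matrix X X ℝ) (-t) + t • K := by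
    rw [Algebra.algebraMap_eq_smul_one, smul_sub, neg_smul, neg_smul, sub_neg_eq_add]
  have hscalar : NormedSpace.exp (algebraMap ℝ (Matrix X X ℝ) (-t)) =
      algebraMap ℝ (Matrix X X ℝ) (Real.exp (-t)) := by
    rw [Real.exp_eq_exp_ℝ]
    exact (NormedSpace.algebraMap_exp_comm (-t)).symm
  have hexp : semigroup K t = Real.exp (-t) • NormedSpace.exp (t • K) := by
    rw [semigroup, hsplit, Matrix.exp_add_of_commute _ _ (Algebra.commute_algebraMap_left _ _),
      hscalar, ← Algebra.smul_def]
  have hterm (k : ℕ) : (Real.exp (-t) * (t ^ k / k.factorial)) • K ^ k =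
      Real.exp (-t) • ((k.factorial : ℝ)⁻¹ • (t • K) ^ k) := by
    rw [smul_pow, smul_smul, smul_smul, mul_assoc, div_eq_inv_mul]
  simp only [hexp, hterm]
  exact (NormedSpace.exp_series_hasSum_exp' (t • K)).const_smul (Real.exp (-t))

theorem semigroup_add (K : Matrix X X ℝ) (s t : ℝ) :
    semigroup K (s + t) = semigroup K s * semigroup K t := by
  rw [semigroup, neg_add, add_smul]
  exact Matrix.exp_add_of_commute _ _ (((Commute.refl _).smul_left _).smul_right _)

theorem IsReversible.semigroup (h : IsReversible K π) {t : ℝ} (ht : 0 ≤ t) :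
    IsReversible (semigroup K t) π := by
  refine .of_hasSum h.pow (fun k => by positivity) ?_ (hasSum_semigroup K t)
  have := (NormedSpace.expSeries_div_hasSum_exp t).mul_left (Real.exp (-t))
  rwa [← Real.exp_eq_exp_ℝ, ← Real.exp_add, neg_add_cancel, Real.exp_zero] at this

theorem law_apply (K : Matrix X X ℝ) (x : X) (t : ℝ) (y : X) :
    law K x t y = semigroup K t x y := by
  rw [law, Matrix.single_one_vecMul]
  rfl

theorem law_mem_stdSimplex (h : IsReversible K π) (x : X) {t : ℝ} (ht : 0 ≤ t) :
    law K x t ∈ stdSimplex ℝ X := by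
  have hH := (h.semigroup ht).mem_rowStochastic
  simp only [stdSimplex, Set.mem_ofPred_eq, law_apply]
  exact ⟨hH.1 x, Matrix.sum_row_of_mem_rowStochastic hH x⟩

theorem law_add (K : Matrix X X ℝ) (x : X) (s t : ℝ) :
    law K x (s + t) = Matrix.vecMul (law K x s) (semigroup K t) := by
  rw [law, semigroup_add, ← Matrix.vecMul_vecMul, law]

theorem antitone_dTV (h : IsReversible K π) (x : X) :
    Antitone (dTV K π x) := by
  intro s t hst
  have hH := h.semigroup (sub_nonneg.2 hst)
  calc dTV K π x t
      = tv (Matrix.vecMul (law K x s) (semigroup K (t - s)))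
          (Matrix.vecMul π (semigroup K (t - s))) := by
        rw [← law_add, add_sub_cancel, hH.vecMul_eq, dTV]
    _ ≤ dTV K π x s := tv_vecMul_le hH.mem_rowStochastic _ _

theorem antitone_dTwo (h : IsReversible K π) (hπ : ∀ x, 0 < π x) (x : X) :
    Antitone (dTwo K π x) := by
  intro s t hst
  calc dTwo K π x t = lTwo (Matrix.vecMul (law K x s) (semigroup K (t - s))) π := by
        rw [← law_add, add_sub_cancel, dTwo]
    _ ≤ dTwo K π x s := lTwo_vecMul_le (h.semigroup (sub_nonneg.2 hst)) hπ _

end Semigroup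

section Product

variable {ι : Type*} [Fintype ι] {X : ι → Type*}

theorem productMeasure_pos {π : ∀ i, X i → ℝ} (hπ : ∀ i a, 0 < π i a) (x : ∀ i, X i) :
    0 < productMeasure π x :=
  Finset.prod_pos fun i _ => hπ i (x i)

variable [DecidableEq ι]

theorem sum_productMeasure [∀ i, Fintype (X i)] (f : ∀ i, X i → ℝ) :
    ∑ x, productMeasure f x = ∏ i, ∑ a, f i a :=
  (Fintype.prod_sum f).symm

theorem productMeasure_mem_stdSimplex [∀ i, Fintype (X i)] {μ : ∀ i, X i → ℝ}
    (hμ : ∀ i, μ i ∈ stdSimplex ℝ (X i)) : productMeasure μ ∈ stdSimplex ℝ (∀ i, X i) :=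
  ⟨fun x => Finset.prod_nonneg fun i _ => (hμ i).1 (x i), by
    simp only [sum_productMeasure, (hμ _).2, Finset.prod_const_one]⟩

theorem one_add_lTwo_productMeasure_sq [∀ i, Fintype (X i)] {μ π : ∀ i, X i → ℝ}
    (hπ : ∀ i a, 0 < π i a) (hμ_sum : ∀ i, ∑ a, μ i a = 1) (hπ_sum : ∀ i, ∑ a, π i a = 1) :
    1 + lTwo (productMeasure μ) (productMeasure π) ^ 2 = ∏ i, (1 + lTwo (μ i) (π i) ^ 2) := by
  rw [one_add_lTwo_sq (productMeasure_pos hπ)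
    (by simp only [sum_productMeasure, hμ_sum, Finset.prod_const_one])
    (by simp only [sum_productMeasure, hπ_sum, Finset.prod_const_one])]
  simp only [one_add_lTwo_sq (hπ _) (hμ_sum _) (hπ_sum _), Fintype.prod_sum, productMeasure,
    Finset.prod_div_distrib, Finset.prod_pow]

theorem sum_sqrt_productMeasure [∀ i, Fintype (X i)] {μ π : ∀ i, X i → ℝ}
    (hμ : ∀ i a, 0 ≤ μ i a) (hπ : ∀ i a, 0 ≤ π i a) :
    ∑ x, √(productMeasure μ x * productMeasure π x) = ∏ i, ∑ a, √(μ i a * π i a) := by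
  rw [Fintype.prod_sum]
  refine Finset.sum_congr rfl fun x _ => ?_
  rw [productMeasure, productMeasure, ← Finset.prod_mul_distrib,
    Real.sqrt_prod _ fun i _ => mul_nonneg (hμ i _) (hπ i _)]

theorem one_sub_mul_le_one_add_rpow_neg {c x : ℝ} (hc : 0 ≤ c) (hx : 0 ≤ x) :
    1 - c * x ≤ (1 + x) ^ (-c) := by
  have hlog : Real.log (1 + x) ≤ x := (Real.log_le_sub_one_of_pos (by linarith)).trans_eq (by ring)
  calc 1 - c * x ≤ Real.log (1 + x) * -c + 1 := by
        linarith [mul_le_mul_of_nonneg_left hlog hc]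
    _ ≤ Real.exp (Real.log (1 + x) * -c) := Real.add_one_le_exp _
    _ = (1 + x) ^ (-c) := (Real.rpow_def_of_pos (by linarith) _).symm

theorem one_sub_tv_productMeasure_le [∀ i, Fintype (X i)] {μ π : ∀ i, X i → ℝ} {B : ℝ}
    (hμ : ∀ i, μ i ∈ stdSimplex ℝ (X i)) (hπ : ∀ i a, 0 < π i a) (hπ_sum : ∀ i, ∑ a, π i a = 1)
    (hB₀ : 0 ≤ B) (hB : ∀ i a, μ i a ≤ B * π i a) :
    1 - tv (productMeasure μ) (productMeasure π) ≤
      (1 + lTwo (productMeasure μ) (productMeasure π) ^ 2) ^ (-(1 / (4 * (1 + B)))) := by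
  have affinity_le (i : ι) :
      ∑ a, √(μ i a * π i a) ≤ (1 + lTwo (μ i) (π i) ^ 2) ^ (-(1 / (4 * (1 + B)))) :=
    (sum_sqrt_le (hμ i) (hπ i) (hπ_sum i) (hB i)).trans
      (one_sub_mul_le_one_add_rpow_neg (by positivity) (sq_nonneg _))
  calc 1 - tv (productMeasure μ) (productMeasure π)
      ≤ ∏ i, ∑ a, √(μ i a * π i a) := by
        rw [← sum_sqrt_productMeasure (fun i => (hμ i).1) fun i a => (hπ i a).le]
        exact one_sub_tv_le_sum_sqrt (productMeasure_mem_stdSimplex hμ)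
          fun x => (productMeasure_pos hπ x).le
    _ ≤ ∏ i, (1 + lTwo (μ i) (π i) ^ 2) ^ (-(1 / (4 * (1 + B)))) :=
      Finset.prod_le_prod (fun i _ => Finset.sum_nonneg fun a _ => Real.sqrt_nonneg _)
        fun i _ => affinity_le i
    _ = _ := by
      rw [one_add_lTwo_productMeasure_sq hπ (fun i => (hμ i).2) hπ_sum,
        Real.finsetProd_rpow _ _ fun i _ => by positivity]

end Product

section Tensor

variable {ι : Type*} [Fintype ι] {X : ι → Type*}

theorem tensor_mul [DecidableEq ι] [∀ i, Fintype (X i)] (A B : ∀ i, Matrix (X i) (X i) ℝ) :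
    tensor A * tensor B = tensor (A * B) := by
  ext x y
  simp only [tensor, Matrix.mul_apply, Matrix.of_apply, Pi.mul_apply, Fintype.prod_sum,
    Finset.prod_mul_distrib]

variable [∀ i, DecidableEq (X i)]

theorem tensor_one : tensor (1 : ∀ i, Matrix (X i) (X i) ℝ) = 1 := by
  ext x y
  simp only [tensor, Matrix.of_apply, Pi.one_apply, Matrix.one_apply, Finset.prod_ite_zero,
    Finset.prod_const_one, Finset.mem_univ, forall_true_left, funext_iff]

variable [DecidableEq ι]

theorem tensor_update_apply (i : ι) (A : Matrix (X i) (X i) ℝ) (x y : ∀ i, X i) :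
    tensor (Function.update (1 : ∀ i, Matrix (X i) (X i) ℝ) i A) x y =
      A (x i) (y i) * ∏ j ∈ Finset.univ.erase i, (1 : Matrix (X j) (X j) ℝ) (x j) (y j) := by
  rw [tensor, Matrix.of_apply, ← Finset.mul_prod_erase _ _ (Finset.mem_univ i),
    Function.update_self]
  congr 1
  exact Finset.prod_congr rfl fun j hj => by
    rw [Function.update_of_ne (Finset.ne_of_mem_erase hj), Pi.one_apply]

variable [∀ i, Fintype (X i)]

/-- The embedding `A ↦ I ⊗ ⋯ ⊗ I ⊗ A ⊗ I ⊗ ⋯ ⊗ I` of the matrices of the `i`-th factor. -/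
def coordinate (i : ι) : Matrix (X i) (X i) ℝ →ₐ[ℝ] Matrix (∀ i, X i) (∀ i, X i) ℝ :=
  AlgHom.ofLinearMap
    { toFun := fun A => tensor (Function.update 1 i A)
      map_add' := fun A B => by
        ext x y
        simp only [Matrix.add_apply, tensor_update_apply, add_mul]
      map_smul' := fun r A => by
        ext x y
        simp only [Matrix.smul_apply, tensor_update_apply, smul_eq_mul, mul_assoc,
          RingHom.id_apply] }
    (by
      change tensor (Function.update 1 i 1) = 1
      rw [Function.update_one, tensor_one])
    fun A B => by
      change tensor (Function.update 1 i (A * B)) =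
        tensor (Function.update 1 i A) * tensor (Function.update 1 i B)
      rw [tensor_mul, ← Function.update_mul, one_mul]

theorem coordinate_apply (i : ι) (A : Matrix (X i) (X i) ℝ) :
    coordinate i A = tensor (Function.update 1 i A) := rfl

theorem coordinate_mul_tensor (i : ι) (A : Matrix (X i) (X i) ℝ)
    {B : ∀ i, Matrix (X i) (X i) ℝ} (hB : B i = 1) :
    coordinate i A * tensor B = tensor (Function.update B i A) := by
  rw [coordinate_apply, tensor_mul, ← Function.update_eq_self i B, hB, ← Function.update_mul,
    one_mul, mul_one, Function.update_idem]

theorem commute_coordinate {i j : ι} (hij : i ≠ j) (A : Matrix (X i) (X i) ℝ)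
    (B : Matrix (X j) (X j) ℝ) : Commute (coordinate i A) (coordinate j B) := by
  have swap := Function.update_comm hij.symm B A (1 : ∀ i, Matrix (X i) (X i) ℝ)
  calc coordinate i A * coordinate j B
      = tensor (Function.update (Function.update 1 j B) i A) :=
        coordinate_mul_tensor i A (Function.update_of_ne hij _ _)
    _ = tensor (Function.update (Function.update 1 i A) j B) := congrArg tensor swap
    _ = coordinate j B * coordinate i A :=
        (coordinate_mul_tensor j B (Function.update_of_ne hij.symm _ _)).symm

attribute [local instance] Matrix.linftyOpNormedRing Matrix.linftyOpNormedAlgebra in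
theorem exp_coordinate (i : ι) (A : Matrix (X i) (X i) ℝ) :
    NormedSpace.exp (coordinate i A) = coordinate i (NormedSpace.exp A) :=
  (NormedSpace.map_exp (coordinate i) (coordinate i).toLinearMap.continuous_of_finiteDimensional
    A).symm

theorem exp_sum_coordinate (A : ∀ i, Matrix (X i) (X i) ℝ) :
    NormedSpace.exp (∑ i, coordinate i (A i)) = tensor fun i => NormedSpace.exp (A i) := by
  suffices h : ∀ s : Finset ι, NormedSpace.exp (∑ i ∈ s, coordinate i (A i)) =
      tensor (s.piecewise (fun i => NormedSpace.exp (A i)) 1) by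
    rw [h Finset.univ, Finset.piecewise_univ]
  intro s
  induction s using Finset.induction with
  | empty => rw [Finset.sum_empty, NormedSpace.exp_zero, Finset.piecewise_empty, tensor_one]
  | insert i s hi ih =>
    have hcomm : Commute (coordinate i (A i)) (∑ j ∈ s, coordinate j (A j)) :=
      .sum_right _ _ _ fun j hj => commute_coordinate (ne_of_mem_of_not_mem hj hi).symm _ _
    rw [Finset.sum_insert hi, Matrix.exp_add_of_commute _ _ hcomm, ih, exp_coordinate,
      coordinate_mul_tensor i _ (Finset.piecewise_eq_of_notMem _ _ _ hi),
      Finset.piecewise_insert]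

theorem productMatrix_eq_sum_coordinate (w : ι → ℝ) (K : ∀ i, Matrix (X i) (X i) ℝ) :
    productMatrix w K = ∑ i, w i • coordinate i (K i) := rfl

theorem semigroup_productMatrix {w : ι → ℝ} (hw : ∑ i, w i = 1) (K : ∀ i, Matrix (X i) (X i) ℝ)
    (t : ℝ) : semigroup (productMatrix w K) t = tensor fun i => semigroup (K i) (w i * t) := by
  have generator : (-t) • (1 - productMatrix w K) =
      ∑ i, coordinate i ((-(w i * t)) • (1 - K i)) := by
    simp only [productMatrix_eq_sum_coordinate, map_smul, map_sub, map_one]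
    conv_lhs => rw [← one_smul ℝ (1 : Matrix (∀ i, X i) (∀ i, X i) ℝ), ← hw, Finset.sum_smul]
    rw [← Finset.sum_sub_distrib, Finset.smul_sum]
    refine Finset.sum_congr rfl fun i _ => ?_
    rw [← smul_sub, smul_smul, neg_mul, mul_comm t]
  rw [semigroup, generator, exp_sum_coordinate]
  rfl

theorem law_productMatrix {w : ι → ℝ} (hw : ∑ i, w i = 1) (K : ∀ i, Matrix (X i) (X i) ℝ)
    (x : ∀ i, X i) (t : ℝ) :
    law (productMatrix w K) x t = productMeasure fun i => law (K i) (x i) (w i * t) := by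
  ext y
  simp only [law_apply, semigroup_productMatrix hw, tensor, Matrix.of_apply, productMeasure]

theorem IsReversible.tensor {P : ∀ i, Matrix (X i) (X i) ℝ} {π : ∀ i, X i → ℝ}
    (h : ∀ i, IsReversible (P i) (π i)) : IsReversible (tensor P) (productMeasure π) where
  mem_rowStochastic := by
    refine Matrix.mem_rowStochastic_iff_sum.2 ⟨fun x y => Finset.prod_nonneg fun i _ =>
      Matrix.nonneg_of_mem_rowStochastic (h i).mem_rowStochastic, fun x => ?_⟩
    simp only [ProductCutoff.tensor, Matrix.of_apply, ← Fintype.prod_sum,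
      Matrix.sum_row_of_mem_rowStochastic (h _).mem_rowStochastic, Finset.prod_const_one]
  detailed_balance x y := by
    simp only [ProductCutoff.tensor, Matrix.of_apply, productMeasure, ← Finset.prod_mul_distrib,
      (h _).detailed_balance (x _)]

theorem IsReversible.productMatrix {w : ι → ℝ} (hw : ∀ i, 0 ≤ w i) (hw_sum : ∑ i, w i = 1)
    {K : ∀ i, Matrix (X i) (X i) ℝ} {π : ∀ i, X i → ℝ} (h : ∀ i, IsReversible (K i) (π i)) :
    IsReversible (productMatrix w K) (productMeasure π) := by
  have coordinate_isReversible (i : ι) :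
      IsReversible (coordinate i (K i)) (productMeasure π) := by
    refine .tensor fun j => ?_
    obtain rfl | hj := eq_or_ne j i
    · rw [Function.update_self]; exact h j
    · rw [Function.update_of_ne hj]; exact .one _
  exact .of_hasSum coordinate_isReversible hw (hw_sum ▸ hasSum_fintype w) (hasSum_fintype _)

end Tensor

section Comparison

/-- The two-sided comparison satisfied by a total variation distance `v` and an `L²`-distance `d`
for product chains: `v` is close to `0` exactly when `d` is, and close to `1` exactly when `d` is
large, in both cases with rates depending only on `c`. -/
structure Comparable (c v d : ℝ) : Prop where
  nonneg_right : 0 ≤ d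
  sq_le : v ^ 2 ≤ (1 - v) * d ^ 2
  one_sub_le : 1 - v ≤ (1 + d ^ 2) ^ (-c)

namespace Comparable

variable {c v d : ℝ}

theorem nonneg_left (h : Comparable c v d) (hc : 0 ≤ c) : 0 ≤ v := by
  linarith [h.one_sub_le, Real.rpow_le_one_of_one_le_of_nonpos
    (le_add_of_nonneg_right (sq_nonneg d)) (neg_nonpos.2 hc)]

theorem lt_one (h : Comparable c v d) : v < 1 := by
  by_contra! hv
  have : v ^ 2 ≤ 0 := h.sq_le.trans <| mul_nonpos_of_nonpos_of_nonneg (by linarith) (sq_nonneg d)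
  exact this.not_gt (pow_pos (one_pos.trans_le hv) 2)

theorem left_le_right (h : Comparable c v d) (hc : 0 ≤ c) : v ≤ d := by
  refine (sq_le_sq₀ (h.nonneg_left hc) h.nonneg_right).1 (h.sq_le.trans ?_)
  exact mul_le_of_le_one_left (sq_nonneg d) (by linarith [h.nonneg_left hc])

theorem div_sqrt_le (h : Comparable c v d) : v / √(1 - v) ≤ d := by
  have hv : 0 < 1 - v := sub_pos.2 h.lt_one
  rw [div_le_iff₀ (Real.sqrt_pos.2 hv)]
  refine le_of_pow_le_pow_left₀ two_ne_zero (mul_nonneg h.nonneg_right (Real.sqrt_nonneg _)) ?_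
  rw [mul_pow, Real.sq_sqrt hv.le, mul_comm]
  exact h.sq_le

theorem le_sqrt (h : Comparable c v d) (hc : 0 < c) : d ≤ √((1 - v) ^ (-c)⁻¹ - 1) := by
  refine Real.le_sqrt_of_sq_le (le_sub_iff_add_le'.2 ?_)
  have hd : 0 < 1 + d ^ 2 := by positivity
  rw [Real.le_rpow_inv_iff_of_neg hd (sub_pos.2 h.lt_one) (neg_neg_of_pos hc)]
  exact h.one_sub_le

end Comparable

variable {ι : Type*} {l : Filter ι} {c : ℝ} {v d : ι → ℝ}

theorem tendsto_coe_nhds_zero_iff (hc : 0 < c) (h : ∀ᶠ i in l, Comparable c (v i) (d i)) :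
    Tendsto (fun i => (v i : EReal)) l (𝓝 0) ↔ Tendsto (fun i => (d i : EReal)) l (𝓝 0) := by
  rw [← EReal.coe_zero, EReal.tendsto_coe, EReal.tendsto_coe]
  constructor <;> intro hlim
  · have hbound : Tendsto (fun i => √((1 - v i) ^ (-c)⁻¹ - 1)) l (𝓝 0) := by
      have := (((hlim.const_sub 1).rpow_const (p := (-c)⁻¹) (.inl (by norm_num))).sub_const 1).sqrt
      rwa [sub_zero, Real.one_rpow, sub_self, Real.sqrt_zero] at this
    exact squeeze_zero' (h.mono fun i hi => hi.nonneg_right) (h.mono fun i hi => hi.le_sqrt hc)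
      hbound
  · exact squeeze_zero' (h.mono fun i hi => hi.nonneg_left hc.le)
      (h.mono fun i hi => hi.left_le_right hc.le) hlim

theorem tendsto_coe_nhds_one_iff_top (hc : 0 < c) (h : ∀ᶠ i in l, Comparable c (v i) (d i)) :
    Tendsto (fun i => (v i : EReal)) l (𝓝 1) ↔ Tendsto (fun i => (d i : EReal)) l (𝓝 ⊤) := by
  rw [← EReal.coe_one, EReal.tendsto_coe, EReal.tendsto_coe_nhds_top_iff]
  constructor <;> intro hlim
  · have hden : Tendsto (fun i => √(1 - v i)) l (𝓝[>] 0) := by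
      refine tendsto_nhdsWithin_iff.2 ⟨?_, h.mono fun i hi =>
        Real.sqrt_pos.2 (sub_pos.2 hi.lt_one)⟩
      simpa only [sub_self, Real.sqrt_zero] using (hlim.const_sub 1).sqrt
    exact tendsto_atTop_mono' l (h.mono fun i hi => hi.div_sqrt_le)
      (hlim.pos_mul_atTop one_pos hden.inv_tendsto_nhdsGT_zero)
  · have hbound : Tendsto (fun i => 1 - (1 + d i ^ 2) ^ (-c)) l (𝓝 1) := by
      have := (tendsto_rpow_neg_atTop hc).comp
        (tendsto_atTop_add_const_left l 1 ((tendsto_pow_atTop two_ne_zero).comp hlim))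
      simpa only [sub_zero, Function.comp_def] using this.const_sub 1
    exact tendsto_of_tendsto_of_tendsto_of_le_of_le' hbound tendsto_const_nhds
      (h.mono fun i hi => sub_le_comm.1 hi.one_sub_le) (h.mono fun i hi => hi.lt_one.le)

end Comparison

section Curry

variable {α β γ : Type*} [CompleteLinearOrder γ] [TopologicalSpace γ] [OrderTopology γ]
  [DenselyOrdered γ] {l : Filter α} {f : Filter β} [f.NeBot] {u : α → β → γ} {m : γ}

/-- Turns the iterated limits of `HasWindowCutoff` into limits along a single filter. -/
theorem tendsto_limsup_iff_tendsto_curry (h : ∀ a, ∀ᶠ b in f, m ≤ u a b) :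
    Tendsto (fun a => limsup (u a) f) l (𝓝 m) ↔
      Tendsto (Function.uncurry u) (l.curry f) (𝓝 m) := by
  simp only [tendsto_order, eventually_curry_iff, Function.uncurry]
  constructor <;> rintro ⟨-, hlim⟩
  · exact ⟨fun m' hm' => .of_forall fun a => (h a).mono fun b => hm'.trans_le,
      fun m' hm' => (hlim m' hm').mono fun a => eventually_lt_of_limsup_lt⟩
  · refine ⟨fun m' hm' => .of_forall fun a => hm'.trans_le ?_, fun m' hm' => ?_⟩
    · exact le_limsup_of_frequently_le (h a).frequently
    · obtain ⟨m'', hm, hm''⟩ := exists_between hm'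
      exact (hlim m'' hm).mono fun a ha => hm''.trans_le' <|
        limsup_le_of_le (h := ha.mono fun b => le_of_lt)

theorem tendsto_liminf_iff_tendsto_curry (h : ∀ a, ∀ᶠ b in f, u a b ≤ m) :
    Tendsto (fun a => liminf (u a) f) l (𝓝 m) ↔
      Tendsto (Function.uncurry u) (l.curry f) (𝓝 m) :=
  tendsto_limsup_iff_tendsto_curry (γ := γᵒᵈ) h

end Curry

section Cutoff

variable {c : ℝ} {V D : ℕ → ℝ → ℝ} {t b : ℕ → ℝ}

theorem eventually_window_nonneg (ht : ∀ n, 0 < t n) (hb : b =o[atTop] t) (a : ℝ) :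
    ∀ᶠ n in atTop, 0 ≤ t n + a * b n := by
  filter_upwards [(hb.const_mul_left a).bound one_pos] with n hn
  rw [one_mul, Real.norm_eq_abs, Real.norm_of_nonneg (ht n).le] at hn
  linarith [neg_abs_le (a * b n)]

theorem hasWindowCutoff_one_iff_top (hc : 0 < c)
    (h : ∀ n s, 0 ≤ s → Comparable c (V n s) (D n s)) :
    HasWindowCutoff 1 V t b ↔ HasWindowCutoff ⊤ D t b := by
  refine and_congr_right fun ht => and_congr_right fun _ => and_congr_right fun hbt => ?_
  have comparable (a : ℝ) :
      ∀ᶠ n in atTop, Comparable c (V n (t n + a * b n)) (D n (t n + a * b n)) :=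
    (eventually_window_nonneg ht hbt a).mono fun n => h n _
  have comparable_curry (l : Filter ℝ) : ∀ᶠ q : ℝ × ℕ in l.curry atTop,
      Comparable c (V q.2 (t q.2 + q.1 * b q.2)) (D q.2 (t q.2 + q.1 * b q.2)) :=
    eventually_curry_iff.2 (.of_forall comparable)
  refine and_congr ?_ ?_
  · rw [tendsto_limsup_iff_tendsto_curry, tendsto_limsup_iff_tendsto_curry]
    · exact tendsto_coe_nhds_zero_iff hc (comparable_curry atTop)
    · exact fun a => (comparable a).mono fun n hn => EReal.coe_nonneg.2 hn.nonneg_right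
    · exact fun a => (comparable a).mono fun n hn => EReal.coe_nonneg.2 (hn.nonneg_left hc.le)
  · rw [tendsto_liminf_iff_tendsto_curry, tendsto_liminf_iff_tendsto_curry]
    · exact tendsto_coe_nhds_one_iff_top hc (comparable_curry atBot)
    · exact fun a => .of_forall fun n => le_top
    · exact fun a => (comparable a).mono fun n hn => EReal.coe_le_coe hn.lt_one.le

/-- The sequence `t` witnesses the cutoff of the family `d` in `HasCutoff M d`. -/
def IsCutoffTime (M : EReal) (d : ℕ → ℝ → ℝ) (t : ℕ → ℝ) : Prop :=
  (∀ n, 0 < t n) ∧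
    (∀ a : ℝ, 1 < a → Tendsto (fun n => (d n (a * t n) : EReal)) atTop (𝓝 0)) ∧
    (∀ a : ℝ, 0 < a → a < 1 → Tendsto (fun n => (d n (a * t n) : EReal)) atTop (𝓝 M))

theorem isCutoffTime_one_iff_top (hc : 0 < c)
    (h : ∀ n s, 0 ≤ s → Comparable c (V n s) (D n s)) :
    IsCutoffTime 1 V t ↔ IsCutoffTime ⊤ D t := by
  refine and_congr_right fun ht => ?_
  have comparable {a : ℝ} (ha : 0 < a) :
      ∀ᶠ n in atTop, Comparable c (V n (a * t n)) (D n (a * t n)) :=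
    .of_forall fun n => h n _ (mul_pos ha (ht n)).le
  exact and_congr
    (forall₂_congr fun a ha => tendsto_coe_nhds_zero_iff hc (comparable (one_pos.trans ha)))
    (forall₃_congr fun a ha _ => tendsto_coe_nhds_one_iff_top hc (comparable ha))

theorem hasCutoff_one_iff_top (hc : 0 < c)
    (h : ∀ n s, 0 ≤ s → Comparable c (V n s) (D n s)) :
    HasCutoff 1 V ↔ HasCutoff ⊤ D :=
  exists_congr fun _ => isCutoffTime_one_iff_top hc h

theorem IsCutoffTime.tendsto_mixingTime_div {M : EReal} {d : ℕ → ℝ → ℝ}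
    (ht : IsCutoffTime M d t) (hd : ∀ n, Antitone (d n)) {ε : ℝ} (hε : 0 < ε)
    (hεM : (ε : EReal) < M) :
    Tendsto (fun n => mixingTime (d n) ε / t n) atTop (𝓝 1) := by
  obtain ⟨ht_pos, hafter, hbefore⟩ := ht
  have eventually_le (a : ℝ) (ha : 1 < a) : ∀ᶠ n in atTop, d n (a * t n) ≤ ε :=
    ((hafter a ha).eventually_lt_const (EReal.coe_pos.2 hε)).mono fun n hn =>
      (EReal.coe_lt_coe_iff.1 hn).le
  have eventually_lt (a : ℝ) (ha₀ : 0 < a) (ha₁ : a < 1) : ∀ᶠ n in atTop, ε < d n (a * t n) :=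
    ((hbefore a ha₀ ha₁).eventually_const_lt hεM).mono fun n => EReal.coe_lt_coe_iff.1
  have mul_time_nonneg {a : ℝ} (ha : 0 < a) (n : ℕ) : 0 ≤ a * t n := (mul_pos ha (ht_pos n)).le
  refine tendsto_order.2 ⟨fun a ha => ?_, fun a ha => ?_⟩
  · obtain ⟨a', haa', ha'⟩ := exists_between (max_lt ha zero_lt_one)
    obtain ⟨haa', ha'₀⟩ := max_lt_iff.1 haa'
    filter_upwards [eventually_lt a' ha'₀ ha', eventually_le 2 one_lt_two] with n hlt hle
    rw [lt_div_iff₀ (ht_pos n)]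
    refine (mul_lt_mul_of_pos_right haa' (ht_pos n)).trans_le <|
      le_csInf ⟨2 * t n, mul_time_nonneg two_pos n, hle⟩ fun s hs => ?_
    exact ((hd n).reflect_lt (hs.2.trans_lt hlt)).le
  · obtain ⟨a', ha', haa'⟩ := exists_between ha
    filter_upwards [eventually_le a' ha'] with n hle
    rw [div_lt_iff₀ (ht_pos n)]
    have bddBelow : BddBelow {s : ℝ | 0 ≤ s ∧ d n s ≤ ε} := ⟨0, fun s hs => hs.1⟩
    exact (csInf_le bddBelow ⟨mul_time_nonneg (one_pos.trans ha') n, hle⟩).trans_lt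
      (mul_lt_mul_of_pos_right haa' (ht_pos n))

theorem tendsto_mixingTime_div_mixingTime (hc : 0 < c)
    (h : ∀ n s, 0 ≤ s → Comparable c (V n s) (D n s)) (hV : ∀ n, Antitone (V n))
    (hD : ∀ n, Antitone (D n)) (hcutoff : HasCutoff 1 V) {ε δ : ℝ} (hε₀ : 0 < ε) (hε₁ : ε < 1)
    (hδ : 0 < δ) :
    Tendsto (fun n => mixingTime (V n) ε / mixingTime (D n) δ) atTop (𝓝 1) := by
  obtain ⟨t, htV⟩ : ∃ t, IsCutoffTime 1 V t := hcutoff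
  have htD : IsCutoffTime ⊤ D t := (isCutoffTime_one_iff_top hc h).1 htV
  have := (htV.tendsto_mixingTime_div hV hε₀ (EReal.coe_lt_coe hε₁)).div
    (htD.tendsto_mixingTime_div hD hδ (EReal.coe_lt_top δ)) one_ne_zero
  rw [div_one] at this
  exact this.congr fun n => div_div_div_cancel_right₀ (htV.1 n).ne' _ _

end Cutoff

section ProductChain

theorem comparable_productMatrix {ι : Type*} [Fintype ι] [DecidableEq ι] {X : ι → Type*}
    [∀ i, Fintype (X i)] [∀ i, DecidableEq (X i)] {w : ι → ℝ} {K : ∀ i, Matrix (X i) (X i) ℝ}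
    {π : ∀ i, X i → ℝ} {x : ∀ i, X i} {κ t : ℝ} (hw : ∀ i, 0 ≤ w i) (hw_sum : ∑ i, w i = 1)
    (hK : ∀ i, IsReversible (K i) (π i)) (hπ : ∀ i a, 0 < π i a) (hπ_sum : ∀ i, ∑ a, π i a = 1)
    (hκ : 0 < κ) (hx : ∀ i, κ ≤ π i (x i)) (ht : 0 ≤ t) :
    Comparable (1 / (4 * (1 + κ⁻¹))) (dTV (productMatrix w K) (productMeasure π) x t)
      (dTwo (productMatrix w K) (productMeasure π) x t) := by
  have law_mem (i : ι) : law (K i) (x i) (w i * t) ∈ stdSimplex ℝ (X i) :=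
    law_mem_stdSimplex (hK i) (x i) (mul_nonneg (hw i) ht)
  have density_le (i : ι) (a : X i) : law (K i) (x i) (w i * t) a ≤ κ⁻¹ * π i a := by
    have reversed := ((hK i).semigroup (mul_nonneg (hw i) ht)).mul_apply_le
      (fun a => (hπ i a).le) (x i) a
    rw [law_apply, inv_mul_eq_div, le_div_iff₀' hκ]
    refine (mul_le_mul_of_nonneg_right (hx i) ?_).trans reversed
    rw [← law_apply]
    exact (law_mem i).1 a
  rw [dTV, dTwo, law_productMatrix hw_sum]
  exact ⟨lTwo_nonneg _ _, tv_sq_le (productMeasure_mem_stdSimplex law_mem) (productMeasure_pos hπ),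
    one_sub_tv_productMeasure_le law_mem hπ hπ_sum (inv_nonneg.2 hκ.le) density_le⟩

end ProductChain

section TwoState

variable {α β : ℝ}

theorem isReversible_twoState (hα : α ∈ Set.Ioc 0 1) (hβ : β ∈ Set.Ioc 0 1) :
    IsReversible (twoStateK α β) (twoStatePi α β) where
  mem_rowStochastic := by
    refine Matrix.mem_rowStochastic_iff_sum.2 ⟨fun i j => ?_, fun i => ?_⟩
    · fin_cases i <;> fin_cases j <;> simp [twoStateK, hα.1.le, hα.2, hβ.1.le, hβ.2]
    · fin_cases i <;> simp [twoStateK]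
  detailed_balance i j := by
    fin_cases i <;> fin_cases j <;> simp [twoStateK, twoStatePi] <;> ring

theorem twoStatePi_pos (hα : 0 < α) (hβ : 0 < β) (i : Fin 2) : 0 < twoStatePi α β i := by
  have hsum : 0 < α + β := add_pos hα hβ
  fin_cases i
  · exact div_pos hβ hsum
  · exact div_pos hα hsum

theorem sum_twoStatePi (h : α + β ≠ 0) : ∑ i, twoStatePi α β i = 1 := by
  rw [Fin.sum_univ_two]
  simp [twoStatePi, ← add_div, add_comm β, h]

theorem inv_one_add_le_twoStatePi_zero {R : ℝ} (hα : 0 < α) (hβ : 0 < β) (hR : α / β ≤ R) :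
    (1 + R)⁻¹ ≤ twoStatePi α β 0 := by
  calc (1 + R)⁻¹ ≤ (1 + α / β)⁻¹ :=
        inv_anti₀ (add_pos one_pos (div_pos hα hβ)) (add_le_add_right hR 1)
    _ = β / (α + β) := by rw [one_add_div hβ.ne', inv_div, add_comm]
    _ = twoStatePi α β 0 := rfl

end TwoState

end ProductCutoff

theorem proposition5p3_general {ι : ℕ → Type*} [∀ n, Fintype (ι n)] [∀ n, DecidableEq (ι n)]
    {X : ∀ n, ι n → Type*} [∀ n i, Fintype (X n i)] [∀ n i, DecidableEq (X n i)]
    {w : ∀ n, ι n → ℝ} {K : ∀ n i, Matrix (X n i) (X n i) ℝ} {π : ∀ n i, X n i → ℝ}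
    {x : ∀ n i, X n i} {κ : ℝ} (hw : ∀ n i, 0 ≤ w n i) (hw_sum : ∀ n, ∑ i, w n i = 1)
    (hK : ∀ n i, IsReversible (K n i) (π n i)) (hπ : ∀ n i a, 0 < π n i a)
    (hπ_sum : ∀ n i, ∑ a, π n i a = 1) (hκ : 0 < κ) (hx : ∀ n i, κ ≤ π n i (x n i)) :
    let V n := dTV (productMatrix (w n) (K n)) (productMeasure (π n)) (x n)
    let D n := dTwo (productMatrix (w n) (K n)) (productMeasure (π n)) (x n)
    ((HasCutoff 1 V ↔ HasCutoff ⊤ D) ∧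
      (HasCutoff 1 V → ∀ ε δ : ℝ, 0 < ε → ε < 1 → 0 < δ →
        Tendsto (fun n => mixingTime (V n) ε / mixingTime (D n) δ) atTop (𝓝 1))) ∧
    (∀ t b : ℕ → ℝ, HasWindowCutoff 1 V t b ↔ HasWindowCutoff ⊤ D t b) := by
  intro V D
  have hc : 0 < 1 / (4 * (1 + κ⁻¹)) := by positivity
  have comparable (n : ℕ) (s : ℝ) (hs : 0 ≤ s) :
      Comparable (1 / (4 * (1 + κ⁻¹))) (V n s) (D n s) :=
    comparable_productMatrix (hw n) (hw_sum n) (hK n) (hπ n) (hπ_sum n) hκ (hx n) hs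
  have reversible (n : ℕ) := IsReversible.productMatrix (hw n) (hw_sum n) (hK n)
  have hV (n : ℕ) : Antitone (V n) := antitone_dTV (reversible n) (x n)
  have hD (n : ℕ) : Antitone (D n) :=
    antitone_dTwo (reversible n) (productMeasure_pos (hπ n)) (x n)
  exact ⟨⟨hasCutoff_one_iff_top hc comparable, fun hcutoff ε δ hε₀ hε₁ hδ =>
    tendsto_mixingTime_div_mixingTime hc comparable hV hD hcutoff hε₀ hε₁ hδ⟩,
    fun t b => hasWindowCutoff_one_iff_top hc comparable⟩

theorem proposition5p3 (α β p : ℕ → ℝ)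
    (hα : ∀ n, 0 < α n ∧ α n ≤ 1) (hβ : ∀ n, 0 < β n ∧ β n ≤ 1) (hp : ∀ n, 0 < p n)
    (hr : BddAbove (Set.range fun n => α n / β n)) :
    ((HasCutoff 1 (chainTV α β p) ↔ HasCutoff ⊤ (chainTwo α β p)) ∧
      (HasCutoff 1 (chainTV α β p) → ∀ ε δ : ℝ, 0 < ε → ε < 1 → 0 < δ →
        Tendsto (fun n => mixingTime (chainTV α β p n) ε / mixingTime (chainTwo α β p n) δ)
          atTop (𝓝 1))) ∧
    (∀ t b : ℕ → ℝ,
      HasWindowCutoff 1 (chainTV α β p) t b ↔ HasWindowCutoff ⊤ (chainTwo α β p) t b) := by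
  obtain ⟨R, hR⟩ := hr
  replace hR (n : ℕ) : α n / β n ≤ R := hR ⟨n, rfl⟩
  have hR_pos : 0 < 1 + R := add_pos one_pos ((div_pos (hα 0).1 (hβ 0).1).trans_le (hR 0))
  have hq (n : ℕ) : 0 < ∑ i : Fin (n + 1), p i :=
    Finset.sum_pos (fun i _ => hp i) Finset.univ_nonempty
  exact proposition5p3_general (fun n i => (div_pos (hp i) (hq n)).le)
    (fun n => by rw [← Finset.sum_div, div_self (hq n).ne'])
    (fun _ i => isReversible_twoState (hα i) (hβ i))
    (fun _ i => twoStatePi_pos (hα i).1 (hβ i).1)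
    (fun _ i => sum_twoStatePi (add_pos (hα i).1 (hβ i).1).ne')
    (inv_pos.2 hR_pos) fun _ i => inv_one_add_le_twoStatePi_zero (hα i).1 (hβ i).1 (hR i)
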